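/- Consider the two-user noiseless memoryless binary multicast channel with additive interference: at each time $i=1,\dots,n$ receiver $k\in\{1,2\}$ observes $Y_{ki}=X_i\oplus S_{ki}$, where $X_i,S_{ki}\in\{0,1\}$ and $\oplus$ is addition modulo two. The pairs $(S_{1i},S_{2i})$, $i=1,2,\dots$, are i.i.d. copies of a pair $(S_1,S_2)$ with an arbitrary joint distribution on $\{0,1\}^2$. The transmitter knows the whole sequences $S_1^n,S_2^n$ before transmission, and the receivers know neither. A $(2^{nR},n)$ code for sending a common message consists of the message set $\mathcal W_n=\{1,\dots,\lceil 2^{nR}\rceil\}$, an encoder $f_n$ mapping $(w,s_1^n,s_2^n)$, with $w\in\mathcal W_n$, to an input sequence $x^n\in\{0,1\}^n$, and decoders $g_{k,n}:\{0,1\}^n\to\mathcal W_n$, $k=1,2$. A rate $R\ge 0$ is achievable if there is a sequence of such codes, one for each $n$, for which, with $W$ uniformly distributed on $\mathcal W_n$ and independent of the interference, $\Pr\{g_{1,n}(Y_1^n)\ne W\text{ or }g_{2,n}(Y_2^n)\ne W\}\to 0$ as $n\to\infty$. The capacity $C$ is the supremum of the achievable rates. Then $$C = 1-\tfrac12 H(S_1\oplus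 S_2),$$ where $H$ denotes Shannon entropy in bits. -/

import Mathlib

open Filter Topology

/-- Shannon entropy, in bits, of a probability distribution on a finite alphabet. -/
noncomputable def entropyBits {α : Type*} [Fintype α] (p : PMF α) : ℝ :=
  ∑ a, -((p a).toReal * Real.logb 2 (p a).toReal)

/-- A `K`-user discrete memoryless multicast channel with random parameters: input alphabet `X`,
state alphabet `S`, output alphabet `Y k` for receiver `k`. -/
structure MulticastChannel (K : ℕ) (X S : Type) (Y : Fin K → Type) where
  /-- The law `p(s)` of one state symbol; the state sequence is i.i.d. with this law. -/
  stateLaw : PMF S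
  /-- The single-letter law `p(y₁, …, y_K | x, s)`. -/
  trans : X → S → PMF (∀ k, Y k)

/-- A code of block length `n` with `M` messages. The encoder sees the message and the whole state
sequence; the decoder of receiver `k` sees the output sequence of receiver `k` only. -/
structure MulticastCode (K : ℕ) (X S : Type) (Y : Fin K → Type) (M n : ℕ) where
  enc : Fin M → (Fin n → S) → (Fin n → X)
  dec : ∀ k, (Fin n → Y k) → Fin M

namespace MulticastChannel

variable {K : ℕ} {X S : Type} {Y : Fin K → Type} [Fintype S] [∀ k, Fintype (Y k)]

open Classical in
/-- The probability that at least one receiver decodes incorrectly, when the message is uniform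
on `Fin M`, the state symbols are i.i.d. and independent of the message, and, given the input and
state sequences, the outputs are drawn from the memoryless extension of the channel. Here `y i k`
is the symbol obtained by receiver `k` at time `i`. -/
noncomputable def errorProb (ch : MulticastChannel K X S Y) {M n : ℕ}
    (c : MulticastCode K X S Y M n) : ℝ :=
  ∑ w : Fin M, (1 / (M : ℝ)) *
    ∑ s : Fin n → S, (∏ i, (ch.stateLaw (s i)).toReal) *
      ∑ y : Fin n → (∀ k, Y k), (∏ i, (ch.trans (c.enc w s i) (s i) (y i)).toReal) *
        (if ∃ k, c.dec k (fun i => y i k) ≠ w then 1 else 0)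

/-- The rate `R` (in bits per channel use) is achievable: there are codes with `⌈2 ^ (n R)⌉`
messages and block length `n`, for every `n`, whose error probabilities tend to `0`. -/
def Achievable (ch : MulticastChannel K X S Y) (R : ℝ) : Prop :=
  0 ≤ R ∧ ∃ c : ∀ n : ℕ, MulticastCode K X S Y ⌈(2 : ℝ) ^ ((n : ℝ) * R)⌉₊ n,
    Tendsto (fun n => ch.errorProb (c n)) atTop (𝓝 0)

/-- `C` is the capacity: the supremum of the achievable rates (as a least upper bound, so that
in particular the set of achievable rates is nonempty and bounded). -/
def IsCapacity (ch : MulticastChannel K X S Y) (C : ℝ) : Prop :=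
  IsLUB {R | ch.Achievable R} C

end MulticastChannel

/-- The `K`-user noiseless binary channel with additive interference: `Y_k = X ⊕ S_k`, where the
tuple `(S_1, …, S_K)` has joint law `p`. Addition in `ZMod 2` is exclusive-or. -/
noncomputable def noiselessBinaryChannel {K : ℕ} (p : PMF (Fin K → ZMod 2)) :
    MulticastChannel K (ZMod 2) (Fin K → ZMod 2) (fun _ => ZMod 2) where
  stateLaw := p
  trans x s := PMF.pure (fun k => x + s k)

/-! Write `Z = S₁ ⊕ S₂` and `H = H(Z)`. Achievability: on half of the block the encoder cancels the
interference of one receiver, on the other half that of the other. Each receiver then sees a common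
codeword `u w` plus noise that is an i.i.d. copy of `Z` on one half and zero on the other. About `2
^ (n H / 2)` noise sequences are typical, so one random codebook serves both receivers at every rate
below `1 - H / 2` (`exists_codebook`, `exists_code_errorProb_le`).

Converse: if both receivers decode `w`, the unknown input cancels in `Y₁ ⊕ Y₂ = Zⁿ`, so `Zⁿ` lies in
the sumset of the two decoding regions of `w`. For a suitable `w` each region has size at most a
constant times `2 ^ n / M`, while a set carrying most of the law of `Zⁿ` needs about `2 ^ (n H)`
points. Hence `H ≤ 2 (1 - R)` (`le_of_errorProb_le`).

Both halves rest on Chernoff bounds for `log q(Z)`. -/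

/-! ### Chernoff bounds and typical sequences -/

theorem sum_pi_prod {n : ℕ} {α : Type*} [Fintype α] (g : Fin n → α → ℝ) :
    ∑ s : Fin n → α, ∏ i, g i (s i) = ∏ i, ∑ a, g i a := by
  classical
  rw [Finset.prod_univ_sum, Fintype.piFinset_univ]

/-- Exponential tilting: a random variable with negative mean has an exponential moment
below one. -/
theorem exists_exp_moment_lt_one {α : Type*} [Fintype α] {q : α → ℝ} (hq : ∀ a, 0 ≤ q a)
    (hq1 : ∑ a, q a = 1) (f : α → ℝ) (hf : ∑ a, q a * f a < 0) :
    ∃ t > 0, 0 ≤ ∑ a, q a * Real.exp (t * f a) ∧ ∑ a, q a * Real.exp (t * f a) < 1 := by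
  -- The moment generating function is 1 at zero and its slope there is the mean, so it drops below
  -- 1 just to the right of zero.
  have hd : HasDerivAt (fun t : ℝ => ∑ a, q a * Real.exp (t * f a)) (∑ a, q a * f a) 0 := by
    have h : ∀ a ∈ (Finset.univ : Finset α),
        HasDerivAt (fun t : ℝ => q a * Real.exp (t * f a)) (q a * f a) 0 := by
      intro a _
      have := ((((hasDerivAt_id (0 : ℝ)).mul_const (f a)).exp).const_mul (q a))
      simpa using this
    exact HasDerivAt.fun_sum h
  have hs := hd.tendsto_slope.eventually (gt_mem_nhds hf)
  have hs' : ∀ᶠ t in 𝓝[>] (0 : ℝ),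
      slope (fun t : ℝ => ∑ a, q a * Real.exp (t * f a)) 0 t < 0 :=
    hs.filter_mono (nhdsWithin_mono _ fun x hx => ne_of_gt hx)
  obtain ⟨t, ht, ht0⟩ := (hs'.and self_mem_nhdsWithin).exists
  have ht0 : 0 < t := ht0
  refine ⟨t, ht0, Finset.sum_nonneg fun a _ => mul_nonneg (hq a) (Real.exp_pos _).le, ?_⟩
  rw [slope_def_field, div_lt_iff₀ (by linarith)] at ht
  simp only [zero_mul, Real.exp_zero, mul_one, hq1] at ht
  linarith

open Classical in
/-- Chernoff's bound for the sum, over some of the coordinates, of i.i.d. random variables with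
negative mean. Only sequences of positive probability have to satisfy the threshold condition. -/
theorem exists_chernoff_bound {α : Type*} [Fintype α] {q : α → ℝ} (hq : ∀ a, 0 ≤ q a)
    (hq1 : ∑ a, q a = 1) (f : α → ℝ) (hf : ∑ a, q a * f a < 0) :
    ∃ ρ, 0 ≤ ρ ∧ ρ < 1 ∧ ∀ (n : ℕ) (B : Finset (Fin n)) (E : (Fin n → α) → Prop),
      (∀ e, (∀ i, 0 < q (e i)) → E e → 0 ≤ ∑ i ∈ B, f (e i)) →
      ∑ e : Fin n → α, (∏ i, q (e i)) * (if E e then 1 else 0) ≤ ρ ^ B.card := by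
  obtain ⟨t, ht, h0, h1⟩ := exists_exp_moment_lt_one hq hq1 f hf
  refine ⟨_, h0, h1, fun n B E hE => ?_⟩
  have key : ∑ e : Fin n → α, ∏ i, q (e i) * (if i ∈ B then Real.exp (t * f (e i)) else 1) =
      (∑ a, q a * Real.exp (t * f a)) ^ B.card := by
    rw [sum_pi_prod (fun i a => q a * (if i ∈ B then Real.exp (t * f a) else 1))]
    rw [← Finset.prod_const, ← Finset.prod_subset (Finset.subset_univ B)]
    · refine Finset.prod_congr rfl fun i hi => ?_
      simp [hi]
    · intro i _ hi
      simp [hi, hq1]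
  rw [← key]
  refine Finset.sum_le_sum fun e _ => ?_
  rw [Finset.prod_mul_distrib]
  -- Markov: the indicator is at most `exp (t * ∑ f)`. Sequences of weight zero are set aside, as
  -- `logb 2 0 = 0` makes the threshold condition meaningless for them.
  by_cases hpos : ∀ i, 0 < q (e i)
  · refine mul_le_mul_of_nonneg_left ?_ (Finset.prod_nonneg fun i _ => hq _)
    rw [Finset.prod_ite_mem, Finset.univ_inter, ← Real.exp_sum, ← Finset.mul_sum]
    split_ifs with h
    · exact Real.one_le_exp (mul_nonneg ht.le (hE e hpos h))
    · exact (Real.exp_pos _).le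
  · push Not at hpos
    obtain ⟨i, hi⟩ := hpos
    have : ∏ i, q (e i) = 0 := Finset.prod_eq_zero (Finset.mem_univ i) (le_antisymm hi (hq _))
    simp [this]

theorem logb_prod_eq_sum {α : Type*} {q : α → ℝ} {n : ℕ} {e : Fin n → α}
    (he : ∀ i, 0 < q (e i)) (B : Finset (Fin n)) :
    Real.logb 2 (∏ i ∈ B, q (e i)) = ∑ i ∈ B, Real.logb 2 (q (e i)) :=
  Real.logb_prod _ _ fun i _ => (he i).ne'

open Classical in
/-- A sequence of i.i.d. symbols is unlikely to have a probability much below `2 ^ (-m H)`. -/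
theorem exists_atypical_low_bound {α : Type*} [Fintype α] {q : α → ℝ} (hq : ∀ a, 0 ≤ q a)
    (hq1 : ∑ a, q a = 1) {H ε : ℝ} (hH : ∑ a, -(q a * Real.logb 2 (q a)) = H) (hε : 0 < ε) :
    ∃ ρ, 0 ≤ ρ ∧ ρ < 1 ∧ ∀ (n : ℕ) (B : Finset (Fin n)),
      ∑ e : Fin n → α, (∏ i, q (e i)) *
        (if ∏ i ∈ B, q (e i) < (2 : ℝ) ^ (-(B.card * (H + ε))) then 1 else 0) ≤ ρ ^ B.card := by
  -- The mean is exactly `-ε`.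
  have hf : ∑ a, q a * (-Real.logb 2 (q a) - (H + ε)) < 0 := by
    simp only [mul_sub, mul_neg, Finset.sum_sub_distrib, ← Finset.sum_mul, hq1, hH]
    linarith
  obtain ⟨ρ, h0, h1, h⟩ := exists_chernoff_bound hq hq1 _ hf
  refine ⟨ρ, h0, h1, fun n B => h n B _ fun e he hE => ?_⟩
  rw [← Real.logb_lt_iff_lt_rpow one_lt_two (Finset.prod_pos fun i _ => he i),
    logb_prod_eq_sum he] at hE
  rw [Finset.sum_sub_distrib, Finset.sum_neg_distrib, Finset.sum_const, nsmul_eq_mul]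
  linarith

open Classical in
/-- A sequence of i.i.d. symbols is unlikely to have a probability much above `2 ^ (-m H)`. -/
theorem exists_atypical_high_bound {α : Type*} [Fintype α] {q : α → ℝ} (hq : ∀ a, 0 ≤ q a)
    (hq1 : ∑ a, q a = 1) {H ε : ℝ} (hH : ∑ a, -(q a * Real.logb 2 (q a)) = H) (hε : 0 < ε) :
    ∃ ρ, 0 ≤ ρ ∧ ρ < 1 ∧ ∀ (n : ℕ) (B : Finset (Fin n)),
      ∑ e : Fin n → α, (∏ i, q (e i)) *
        (if (2 : ℝ) ^ (-(B.card * (H - ε))) < ∏ i ∈ B, q (e i) then 1 else 0) ≤ ρ ^ B.card := by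
  have hf : ∑ a, q a * (Real.logb 2 (q a) + (H - ε)) < 0 := by
    rw [Finset.sum_neg_distrib] at hH
    simp only [mul_add, Finset.sum_add_distrib, ← Finset.sum_mul, hq1]
    linarith
  obtain ⟨ρ, h0, h1, h⟩ := exists_chernoff_bound hq hq1 _ hf
  refine ⟨ρ, h0, h1, fun n B => h n B _ fun e he hE => ?_⟩
  rw [← Real.lt_logb_iff_rpow_lt one_lt_two (Finset.prod_pos fun i _ => he i),
    logb_prod_eq_sum he] at hE
  rw [Finset.sum_add_distrib, Finset.sum_const, nsmul_eq_mul]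
  linarith

/-! ### Pushforwards of i.i.d. laws and the error probability -/

theorem PMF.sum_toReal {α : Type*} [Fintype α] (p : PMF α) : ∑ a, (p a).toReal = 1 := by
  rw [← ENNReal.toReal_sum fun a _ => p.apply_ne_top a, ← tsum_fintype (L := .unconditional α),
    p.tsum_coe, ENNReal.toReal_one]

open Classical in
theorem PMF.toReal_map_apply {α β : Type*} [Fintype α] (p : PMF α) (g : α → β) (b : β) :
    ((p.map g) b).toReal = ∑ a, (p a).toReal * (if g a = b then 1 else 0) := by
  rw [PMF.map_apply, tsum_fintype, ENNReal.toReal_sum]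
  · refine Finset.sum_congr rfl fun a _ => ?_
    by_cases h : g a = b
    · simp [h]
    · simp [h, Ne.symm h]
  · intro a _
    split_ifs
    · exact p.apply_ne_top a
    · exact ENNReal.zero_ne_top

/-- Change of variables for expectations of functions of i.i.d. sequences. -/
theorem PMF.sum_prod_map {α β : Type*} [Fintype α] [Fintype β] (p : PMF α) (g : α → β) {n : ℕ}
    (F : (Fin n → β) → ℝ) :
    ∑ s : Fin n → α, (∏ i, (p (s i)).toReal) * F (fun i => g (s i)) =
      ∑ e : Fin n → β, (∏ i, ((p.map g) (e i)).toReal) * F e := by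
  classical
  have h : ∀ e : Fin n → β, ∏ i, ((p.map g) (e i)).toReal =
      ∑ s : Fin n → α, (∏ i, (p (s i)).toReal) * (if (fun i => g (s i)) = e then 1 else 0) := by
    intro e
    simp only [PMF.toReal_map_apply]
    rw [← sum_pi_prod (fun i a => (p a).toReal * (if g a = e i then 1 else 0))]
    refine Finset.sum_congr rfl fun s _ => ?_
    rw [Finset.prod_mul_distrib, Finset.prod_ite_zero]
    simp [funext_iff]
  simp only [h, Finset.sum_mul]
  rw [Finset.sum_comm]
  refine Finset.sum_congr rfl fun s _ => ?_
  simp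

-- Given input and state the output is deterministic, so a single `y` survives in the inner sum.
open Classical in
theorem errorProb_noiselessBinaryChannel {K M n : ℕ} (p : PMF (Fin K → ZMod 2))
    (c : MulticastCode K (ZMod 2) (Fin K → ZMod 2) (fun _ => ZMod 2) M n) :
    (noiselessBinaryChannel p).errorProb c = ∑ w : Fin M, (1 / (M : ℝ)) *
      ∑ s : Fin n → (Fin K → ZMod 2), (∏ i, (p (s i)).toReal) *
        (if ∃ k, c.dec k (fun i => c.enc w s i + s i k) ≠ w then 1 else 0) := by
  unfold MulticastChannel.errorProb
  refine Finset.sum_congr rfl fun w _ => ?_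
  congr 1
  refine Finset.sum_congr rfl fun s _ => ?_
  congr 1
  rw [Finset.sum_eq_single (fun i k => c.enc w s i + s i k)]
  · simp [noiselessBinaryChannel]
  · intro y _ hy
    obtain ⟨i, hi⟩ := Function.ne_iff.1 hy
    rw [Finset.prod_eq_zero (Finset.mem_univ i), zero_mul]
    simp [noiselessBinaryChannel, PMF.pure_apply, hi]
  · simp

/-! ### Random coding and precoding -/

open Classical in
/-- The difference of two distinct codewords of a uniformly random codebook is uniform. -/
theorem sum_codebook_indicator {V : Type*} [AddCommGroup V] [Fintype V] {M : ℕ} (T : Finset V)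
    (e : V) {w w' : Fin M} (hw : w ≠ w') :
    ∑ u : Fin M → V, (if u w + e - u w' ∈ T then (1 : ℝ) else 0) =
      Fintype.card (Fin M → V) * (T.card / Fintype.card V) := by
  have hshift : ∀ v : V, ∑ u : Fin M → V, (if u w + e - u w' ∈ T then (1 : ℝ) else 0) =
      ∑ u : Fin M → V, (if u w + e - u w' - v ∈ T then (1 : ℝ) else 0) := by
    intro v
    -- Translating codeword `w'` alone leaves `u w` fixed; averaging over all translations `v` then
    -- makes the difference uniform.
    rw [← Equiv.sum_comp (Equiv.addRight (Pi.single w' v : Fin M → V))]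
    refine Finset.sum_congr rfl fun u _ => ?_
    simp [Pi.single_eq_of_ne hw, sub_sub]
  have hN : (Fintype.card V : ℝ) ≠ 0 := by
    exact_mod_cast Fintype.card_ne_zero
  have hsum : (Fintype.card V : ℝ) *
      ∑ u : Fin M → V, (if u w + e - u w' ∈ T then (1 : ℝ) else 0) =
      Fintype.card (Fin M → V) * T.card := by
    have h1 : ∑ v : V, ∑ u : Fin M → V, (if u w + e - u w' ∈ T then (1 : ℝ) else 0) =
        ∑ v : V, ∑ u : Fin M → V, (if u w + e - u w' - v ∈ T then (1 : ℝ) else 0) :=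
      Finset.sum_congr rfl fun v _ => hshift v
    rw [Finset.sum_const, Finset.card_univ, nsmul_eq_mul] at h1
    rw [h1, Finset.sum_comm]
    have h2 : ∀ u : Fin M → V,
        ∑ v : V, (if u w + e - u w' - v ∈ T then (1 : ℝ) else 0) = T.card := by
      intro u
      refine (Equiv.sum_comp (Equiv.subLeft (u w + e - u w'))
        (fun v => if v ∈ T then (1 : ℝ) else 0)).trans ?_
      simp
    simp only [h2]
    simp
  field_simp
  linarith

open Classical in
/-- Random coding for additive noise: some codebook, used by all receivers at once, has an error
probability bounded by the probability of atypical noise plus a collision term. -/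
theorem exists_codebook {V Ω κ : Type*} [AddCommGroup V] [Fintype V] [Fintype Ω] [Fintype κ]
    {M : ℕ} [NeZero M] (μ : Ω → ℝ) (hμ : ∀ s, 0 ≤ μ s) (hμ1 : ∑ s, μ s = 1)
    (e : κ → Ω → V) (T : κ → Finset V) :
    ∃ (u : Fin M → V) (dec : κ → V → Fin M),
      ∑ w : Fin M, (1 / (M : ℝ)) * ∑ s, μ s *
        (if ∃ k, dec k (u w + e k s) ≠ w then 1 else 0) ≤
      ∑ k, (∑ s, μ s * (if e k s ∉ T k then 1 else 0) +
        M * ((T k).card / Fintype.card V)) := by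
  have hM : (M : ℝ) ≠ 0 := by exact_mod_cast NeZero.ne M
  have hMp : (0 : ℝ) < 1 / M := by positivity
  -- Picks any message whose residual noise lies in `T k`. The default 0 is harmless: if the true
  -- noise is in `T k`, then `w` is a candidate, and an error forces a second one, counted by `ind`.
  let dec : (Fin M → V) → κ → V → Fin M := fun u k y =>
    if h : ∃ w, y - u w ∈ T k then h.choose else 0
  let ind : (Fin M → V) → Fin M → κ → Ω → Fin M → ℝ := fun u w k s w' =>
    if w' ≠ w then (if u w + e k s - u w' ∈ T k then (1 : ℝ) else 0) else 0
  have hind0 : ∀ u w k s w', 0 ≤ ind u w k s w' := by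
    intro u w k s w'
    simp only [ind]
    split_ifs <;> norm_num
  have hterm0 : ∀ u w k s, 0 ≤ (if e k s ∉ T k then (1 : ℝ) else 0) + ∑ w', ind u w k s w' := by
    intro u w k s
    refine add_nonneg (by split_ifs <;> norm_num) (Finset.sum_nonneg fun w' _ => hind0 ..)
  have hpt : ∀ u w s, (if ∃ k, dec u k (u w + e k s) ≠ w then (1 : ℝ) else 0) ≤
      ∑ k, ((if e k s ∉ T k then (1 : ℝ) else 0) + ∑ w', ind u w k s w') := by
    intro u w s
    split_ifs with h
    · obtain ⟨k, hk⟩ := h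
      refine le_trans ?_ (Finset.single_le_sum (fun k _ => hterm0 u w k s) (Finset.mem_univ k))
      by_cases hT : e k s ∈ T k
      · have hex : ∃ w', u w + e k s - u w' ∈ T k := ⟨w, by simpa using hT⟩
        have hdec : dec u k (u w + e k s) = hex.choose := dif_pos hex
        rw [hdec] at hk
        have h1 : ind u w k s hex.choose = 1 := by
          simp only [ind]
          rw [if_pos hk, if_pos hex.choose_spec]
        have h2 := Finset.single_le_sum (fun w' _ => hind0 u w k s w')
          (Finset.mem_univ hex.choose)
        rw [h1] at h2
        simpa [hT] using h2
      · rw [if_pos hT]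
        have := Finset.sum_nonneg fun w' (_ : w' ∈ Finset.univ) => hind0 u w k s w'
        linarith
    · exact Finset.sum_nonneg fun k _ => hterm0 u w k s
  have hind : ∀ w k s w', ∑ u, ind u w k s w' ≤
      Fintype.card (Fin M → V) * ((T k).card / Fintype.card V) := by
    intro w k s w'
    by_cases hw : w' = w
    · simp only [ind, hw, ne_eq, not_true_eq_false, if_false, Finset.sum_const_zero]
      positivity
    · simp only [ind, ne_eq, hw, not_false_eq_true, if_true]
      exact (sum_codebook_indicator (T k) (e k s) (Ne.symm hw)).le
  have havg : ∑ u : Fin M → V, (∑ w : Fin M, (1 / (M : ℝ)) * ∑ s, μ s *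
        (if ∃ k, dec u k (u w + e k s) ≠ w then 1 else 0)) ≤
      ∑ _u : Fin M → V, ∑ k, (∑ s, μ s * (if e k s ∉ T k then 1 else 0) +
        M * ((T k).card / Fintype.card V)) := by
    rw [Finset.sum_const, Finset.card_univ, nsmul_eq_mul, Finset.sum_comm]
    have hw : ∀ w : Fin M, ∑ u : Fin M → V, (1 / (M : ℝ)) * ∑ s, μ s *
        (if ∃ k, dec u k (u w + e k s) ≠ w then 1 else 0) ≤
        (1 / (M : ℝ)) * (Fintype.card (Fin M → V) *
          ∑ k, (∑ s, μ s * (if e k s ∉ T k then 1 else 0) +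
            M * ((T k).card / Fintype.card V))) := by
      intro w
      rw [← Finset.mul_sum]
      refine mul_le_mul_of_nonneg_left ?_ hMp.le
      rw [Finset.sum_comm]
      have hs : ∀ s, ∑ u : Fin M → V, μ s *
          (if ∃ k, dec u k (u w + e k s) ≠ w then (1 : ℝ) else 0) ≤
          μ s * (Fintype.card (Fin M → V) * ∑ k, ((if e k s ∉ T k then (1 : ℝ) else 0) +
            M * ((T k).card / Fintype.card V))) := by
        intro s
        rw [← Finset.mul_sum]
        refine mul_le_mul_of_nonneg_left ?_ (hμ s)
        refine (Finset.sum_le_sum fun u _ => hpt u w s).trans ?_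
        rw [Finset.sum_comm, Finset.mul_sum]
        refine Finset.sum_le_sum fun k _ => ?_
        rw [Finset.sum_add_distrib, Finset.sum_const, Finset.card_univ, nsmul_eq_mul, mul_add]
        refine add_le_add le_rfl ?_
        rw [Finset.sum_comm]
        refine (Finset.sum_le_sum fun w' _ => hind w k s w').trans ?_
        rw [Finset.sum_const, Finset.card_univ, Fintype.card_fin, nsmul_eq_mul]
        exact le_of_eq (by ring)
      refine (Finset.sum_le_sum fun s _ => hs s).trans (le_of_eq ?_)
      simp only [Finset.mul_sum]
      rw [Finset.sum_comm]
      refine Finset.sum_congr rfl fun k _ => ?_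
      have : ∀ s, μ s * ((Fintype.card (Fin M → V) : ℝ) *
          ((if e k s ∉ T k then 1 else 0) + M * ((T k).card / Fintype.card V))) =
          (Fintype.card (Fin M → V) : ℝ) * (μ s * (if e k s ∉ T k then 1 else 0)) +
          μ s * (Fintype.card (Fin M → V) * (M * ((T k).card / Fintype.card V))) := by
        intro s; ring
      simp only [this]
      rw [Finset.sum_add_distrib, ← Finset.mul_sum, ← Finset.sum_mul, hμ1]
      ring
    refine (Finset.sum_le_sum fun w _ => hw w).trans (le_of_eq ?_)
    rw [Finset.sum_const, Finset.card_univ, Fintype.card_fin, nsmul_eq_mul, ← mul_assoc,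
      mul_one_div_cancel hM, one_mul]
  obtain ⟨u, -, hu⟩ := Finset.exists_le_of_sum_le Finset.univ_nonempty havg
  exact ⟨u, dec u, hu⟩

open Classical in
/-- Fewer than `1 / θ` sequences have probability at least `θ`. -/
theorem card_filter_prod_le {n : ℕ} {α : Type*} [Fintype α] (Q : Fin n → α → ℝ)
    (hQ : ∀ i a, 0 ≤ Q i a) (hQ1 : ∀ i, ∑ a, Q i a = 1) {θ : ℝ} (hθ : 0 < θ) :
    ((Finset.univ.filter fun e : Fin n → α => θ ≤ ∏ i, Q i (e i)).card : ℝ) ≤ θ⁻¹ := by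
  have h1 : ∑ e : Fin n → α, ∏ i, Q i (e i) = 1 := by
    rw [sum_pi_prod]
    simp [hQ1]
  rw [← one_div, le_div_iff₀ hθ, ← nsmul_eq_mul, ← h1]
  refine (Finset.card_nsmul_le_sum _ _ _ fun e he => (Finset.mem_filter.1 he).2).trans ?_
  exact Finset.sum_le_sum_of_subset_of_nonneg (Finset.filter_subset _ _)
    fun e _ _ => Finset.prod_nonneg fun i _ => hQ i _

open Classical in
/-- The half-and-half precoding scheme: the interference of one receiver is cancelled on part of
the block, that of the other receiver on the rest. -/
theorem exists_code_errorProb_le (p : PMF (Fin 2 → ZMod 2)) {M n : ℕ} [NeZero M] {ρ h : ℝ}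
    (B : Fin 2 → Finset (Fin n)) (hB : B 1 = (B 0)ᶜ)
    (hρ : ∀ k, ∑ e : Fin n → ZMod 2,
      (∏ i, ((p.map fun s => s 0 + s 1) (e i)).toReal) *
        (if ∏ i ∈ B k, ((p.map fun s => s 0 + s 1) (e i)).toReal <
          (2 : ℝ) ^ (-((B k).card * h)) then 1 else 0) ≤ ρ ^ (B k).card) :
    ∃ c : MulticastCode 2 (ZMod 2) (Fin 2 → ZMod 2) (fun _ => ZMod 2) M n,
      (noiselessBinaryChannel p).errorProb c ≤
        ∑ k, (ρ ^ (B k).card + M * ((2 : ℝ) ^ ((B k).card * h) / 2 ^ n)) := by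
  set q : ZMod 2 → ℝ := fun z => ((p.map fun s => s 0 + s 1) z).toReal
  -- The noise law of receiver `k`: a point mass at zero off `B k`, so that counting likely
  -- sequences over the whole block costs only the entropy on `B k`.
  let Q : Fin 2 → Fin n → ZMod 2 → ℝ := fun k i a => if i ∈ B k then q a else if a = 0 then 1 else 0
  let T : Fin 2 → Finset (Fin n → ZMod 2) := fun k =>
    Finset.univ.filter fun e => (2 : ℝ) ^ (-((B k).card * h)) ≤ ∏ i, Q k i (e i)
  let noise : Fin 2 → (Fin n → ZMod 2) → (Fin n → ZMod 2) := fun k z i =>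
    if i ∈ B k then z i else 0
  obtain ⟨u, dec, hu⟩ := exists_codebook (M := M)
    (fun s : Fin n → (Fin 2 → ZMod 2) => ∏ i, (p (s i)).toReal)
    (fun s => Finset.prod_nonneg fun i _ => ENNReal.toReal_nonneg)
    (by rw [sum_pi_prod (fun _ a => (p a).toReal)]; simp [PMF.sum_toReal])
    (fun k s => noise k fun i => s i 0 + s i 1) T
  -- On `B k` the interference of the other receiver is cancelled, so `B k` is where receiver `k`
  -- sees noise.
  refine ⟨⟨fun w s i => u w i + if i ∈ B 0 then s i 1 else s i 0, dec⟩, ?_⟩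
  rw [errorProb_noiselessBinaryChannel]
  have hy : ∀ (k : Fin 2) (w : Fin M) (s : Fin n → (Fin 2 → ZMod 2)),
      (fun i => (u w i + if i ∈ B 0 then s i 1 else s i 0) + s i k) =
        u w + noise k fun i => s i 0 + s i 1 := by
    intro k w s
    funext i
    simp only [noise, Pi.add_apply, add_assoc]
    congr 1
    fin_cases k <;> by_cases hi : i ∈ B 0 <;> simp [hi, hB, CharTwo.add_self_eq_zero, add_comm]
  simp only [hy]
  refine le_trans (le_of_eq (by congr!))
    (hu.trans (Finset.sum_le_sum fun k _ => add_le_add ?_ ?_))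
  · refine le_trans (le_of_eq (Eq.trans (by congr!) (PMF.sum_prod_map p (fun s => s 0 + s 1)
      (fun z => if noise k z ∉ T k then (1 : ℝ) else 0)))) (le_trans (le_of_eq ?_) (hρ k))
    refine Finset.sum_congr rfl fun z _ => ?_
    have : ∏ i, Q k i (noise k z i) = ∏ i ∈ B k, q (z i) := by
      rw [← Finset.prod_subset (Finset.subset_univ (B k))]
      · exact Finset.prod_congr rfl fun i hi => by simp [Q, noise, hi]
      · intro i _ hi
        simp [Q, noise, hi]
    simp only [T, Finset.mem_filter, Finset.mem_univ, true_and, not_le, this]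
    rfl
  · refine mul_le_mul_of_nonneg_left ?_ (Nat.cast_nonneg M)
    have hc : (Fintype.card (Fin n → ZMod 2) : ℝ) = 2 ^ n := by simp [ZMod.card]
    rw [hc]
    refine div_le_div_of_nonneg_right ?_ (by positivity)
    have := card_filter_prod_le (Q k) (by
      intro i a
      simp only [Q]
      split_ifs
      · exact ENNReal.toReal_nonneg
      · norm_num
      · norm_num) (by
      intro i
      by_cases hi : i ∈ B k
      · simp only [Q, hi, if_true]
        exact PMF.sum_toReal _
      · simp [Q, hi]) (θ := (2 : ℝ) ^ (-((B k).card * h))) (by positivity)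
    refine le_trans (le_of_eq ?_)
      (this.trans (by rw [Real.rpow_neg zero_le_two, inv_inv]))
    simp only [T]

/-! ### Achievability -/

theorem entropyBits_nonneg {α : Type*} [Fintype α] (p : PMF α) : 0 ≤ entropyBits p := by
  refine Finset.sum_nonneg fun a _ => ?_
  rw [neg_nonneg]
  refine mul_nonpos_of_nonneg_of_nonpos ENNReal.toReal_nonneg
    (Real.logb_nonpos one_lt_two ENNReal.toReal_nonneg ?_)
  exact ENNReal.toReal_le_of_le_ofReal zero_le_one (by simpa using p.coe_le_one a)

theorem achievable_of_lt (p : PMF (Fin 2 → ZMod 2)) {R : ℝ} (hR : 0 ≤ R)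
    (hlt : R < 1 - 1 / 2 * entropyBits (p.map (fun s => s 0 + s 1))) :
    (noiselessBinaryChannel p).Achievable R := by
  set H := entropyBits (p.map (fun s => s 0 + s 1)) with hH
  have hH0 : 0 ≤ H := entropyBits_nonneg _
  -- Then `R + (H + ε) / 2 - 1 = -ε / 2`, the exponent of the collision term.
  set ε := 1 - 1 / 2 * H - R with hε
  have hε0 : 0 < ε := by linarith
  obtain ⟨ρ, hρ0, hρ1, hρ⟩ := exists_atypical_low_bound
    (q := fun z => ((p.map fun s => s 0 + s 1) z).toReal)
    (fun _ => ENNReal.toReal_nonneg) (PMF.sum_toReal _) hH.symm hε0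
  let B : ∀ n, Fin 2 → Finset (Fin n) := fun n k =>
    if k = 0 then Finset.univ.filter fun i => (i : ℕ) < n / 2
    else (Finset.univ.filter fun i => (i : ℕ) < n / 2)ᶜ
  have hc0 : ∀ n, (B n 0).card = n / 2 := by
    intro n
    simp only [B, if_true, Fin.card_filter_val_lt]
    omega
  have hc1 : ∀ n, (B n 1).card = n - n / 2 := by
    intro n
    have : B n 1 = (B n 0)ᶜ := rfl
    rw [this, Finset.card_compl, hc0, Fintype.card_fin]
  have hlow : ∀ n k, n / 2 ≤ (B n k).card := by
    intro n k
    fin_cases k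
    · exact (hc0 n).ge
    · refine le_trans ?_ (hc1 n).ge
      omega
  -- For odd `n` the halves are unequal; the extra `1 / 2` costs only the constant factor `2 ^ ((H +
  -- ε) / 2)`.
  have hup : ∀ n k, ((B n k).card : ℝ) ≤ n / 2 + 1 / 2 := by
    intro n k
    have : 2 * (B n k).card ≤ n + 1 := by
      fin_cases k
      · have := hc0 n
        simp only [Fin.zero_eta]
        omega
      · have := hc1 n
        simp only [Fin.mk_one]
        omega
    have : (2 : ℝ) * (B n k).card ≤ n + 1 := by exact_mod_cast this
    linarith
  have hMpos : ∀ n : ℕ, NeZero ⌈(2 : ℝ) ^ ((n : ℝ) * R)⌉₊ := fun n =>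
    ⟨(Nat.ceil_pos.2 (by positivity)).ne'⟩
  have hM : ∀ n : ℕ, (⌈(2 : ℝ) ^ ((n : ℝ) * R)⌉₊ : ℝ) ≤ 2 * 2 ^ ((n : ℝ) * R) := by
    intro n
    have h1 : (1 : ℝ) ≤ 2 ^ ((n : ℝ) * R) := Real.one_le_rpow one_le_two (by positivity)
    have h2 := Nat.ceil_lt_add_one (zero_le_one.trans h1)
    linarith
  choose c hc using fun n =>
    haveI := hMpos n
    exists_code_errorProb_le p (M := ⌈(2 : ℝ) ^ ((n : ℝ) * R)⌉₊) (B n) rfl fun k => hρ n (B n k)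
  refine ⟨hR, c, ?_⟩
  have hbound : ∀ n, (noiselessBinaryChannel p).errorProb (c n) ≤
      2 * (ρ ^ (n / 2) + 2 * 2 ^ ((H + ε) / 2) * ((2 : ℝ) ^ (-(ε / 2))) ^ n) := by
    intro n
    refine (hc n).trans ?_
    rw [two_mul, ← Fin.sum_univ_two (fun _ : Fin 2 =>
      ρ ^ (n / 2) + 2 * 2 ^ ((H + ε) / 2) * ((2 : ℝ) ^ (-(ε / 2))) ^ n)]
    refine Finset.sum_le_sum fun k _ => add_le_add
      (pow_le_pow_of_le_one hρ0 hρ1.le (hlow n k)) ?_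
    calc (⌈(2 : ℝ) ^ ((n : ℝ) * R)⌉₊ : ℝ) * (2 ^ ((B n k).card * (H + ε)) / 2 ^ n)
        ≤ (2 * 2 ^ ((n : ℝ) * R)) * (2 ^ (((n : ℝ) / 2 + 1 / 2) * (H + ε)) / 2 ^ n) := by
          gcongr
          · exact hM n
          · exact one_le_two
          · exact hup n k
      _ = 2 * 2 ^ ((H + ε) / 2) * ((2 : ℝ) ^ (-(ε / 2))) ^ n := by
          rw [← Real.rpow_natCast 2 n, ← Real.rpow_natCast _ n, ← Real.rpow_mul zero_le_two,
            mul_assoc, mul_assoc, ← Real.rpow_sub zero_lt_two, ← Real.rpow_add zero_lt_two,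
            ← Real.rpow_add zero_lt_two]
          congr 2
          rw [hε]
          ring
  have h0 : ∀ n, 0 ≤ (noiselessBinaryChannel p).errorProb (c n) := by
    intro n
    rw [errorProb_noiselessBinaryChannel]
    refine Finset.sum_nonneg fun w _ => mul_nonneg (by positivity) (Finset.sum_nonneg fun s _ =>
      mul_nonneg (Finset.prod_nonneg fun i _ => ENNReal.toReal_nonneg) ?_)
    split_ifs <;> norm_num
  refine squeeze_zero h0 hbound ?_
  have hl1 : Tendsto (fun n : ℕ => ρ ^ (n / 2)) atTop (𝓝 0) :=
    (tendsto_pow_atTop_nhds_zero_of_lt_one hρ0 hρ1).comp (Nat.tendsto_div_const_atTop two_ne_zero)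
  have hl2 : Tendsto (fun n : ℕ => ((2 : ℝ) ^ (-(ε / 2))) ^ n) atTop (𝓝 0) :=
    tendsto_pow_atTop_nhds_zero_of_lt_one (by positivity)
      (Real.rpow_lt_one_of_one_lt_of_neg one_lt_two (by linarith))
  simpa using (hl1.add (hl2.const_mul (2 * (2 : ℝ) ^ ((H + ε) / 2)))).const_mul 2

/-- There is only one message, so no error is possible. This makes every upper bound of the
achievable rates nonnegative. -/
theorem achievable_zero (p : PMF (Fin 2 → ZMod 2)) : (noiselessBinaryChannel p).Achievable 0 := by
  have hM : ∀ n : ℕ, ⌈(2 : ℝ) ^ ((n : ℝ) * 0)⌉₊ = 1 := by simp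
  have hpos : ∀ n : ℕ, 0 < ⌈(2 : ℝ) ^ ((n : ℝ) * 0)⌉₊ := by simp
  refine ⟨le_rfl, fun n => ⟨fun _ _ _ => 0, fun _ _ => ⟨0, hpos n⟩⟩, ?_⟩
  refine tendsto_const_nhds.congr fun n => ?_
  rw [errorProb_noiselessBinaryChannel]
  symm
  refine Finset.sum_eq_zero fun w _ => ?_
  have hw : (⟨0, hpos n⟩ : Fin ⌈(2 : ℝ) ^ ((n : ℝ) * 0)⌉₊) = w := by
    have := w.isLt.trans_eq (hM n)
    exact Fin.ext (by simp only; omega)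
  simp [hw]

/-! ### Converse -/

open Classical in
/-- A small set of sequences has small probability, up to the sequences of large probability. -/
theorem sum_prod_indicator_le {n : ℕ} {α : Type*} [Fintype α] {q : α → ℝ} (hq : ∀ a, 0 ≤ q a)
    (G : Finset (Fin n → α)) {θ : ℝ} (hθ : 0 ≤ θ) :
    ∑ e : Fin n → α, (∏ i, q (e i)) * (if e ∈ G then 1 else 0) ≤
      G.card * θ + ∑ e : Fin n → α, (∏ i, q (e i)) * (if θ < ∏ i, q (e i) then 1 else 0) := by
  have h : (G.card : ℝ) * θ = ∑ e : Fin n → α, if e ∈ G then θ else 0 := by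
    simp
  rw [h, ← Finset.sum_add_distrib]
  refine Finset.sum_le_sum fun e _ => ?_
  have h0 : 0 ≤ ∏ i, q (e i) := Finset.prod_nonneg fun i _ => hq _
  split_ifs with h1 h2 h2
  · linarith
  · linarith
  · linarith
  · linarith

open Classical in
/-- Counting converse: the sum of two decoding regions of a typical message has to contain most of
the interference differences. -/
theorem le_of_errorProb_le (p : PMF (Fin 2 → ZMod 2)) {M n : ℕ} (hM : 0 < M)
    (c : MulticastCode 2 (ZMod 2) (Fin 2 → ZMod 2) (fun _ => ZMod 2) M n)
    (herr : (noiselessBinaryChannel p).errorProb c ≤ 1 / 8) {θ : ℝ} (hθ : 0 ≤ θ) :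
    5 / 8 ≤ 9 * ((2 : ℝ) ^ n / M) ^ 2 * θ + ∑ e : Fin n → ZMod 2,
      (∏ i, ((p.map fun s => s 0 + s 1) (e i)).toReal) *
        (if θ < ∏ i, ((p.map fun s => s 0 + s 1) (e i)).toReal then 1 else 0) := by
  have hM0 : (0 : ℝ) < M := by exact_mod_cast hM
  let D : Fin 2 → Fin M → Finset (Fin n → ZMod 2) := fun k w =>
    Finset.univ.filter fun y => c.dec k y = w
  let err : Fin M → ℝ := fun w => ∑ s : Fin n → (Fin 2 → ZMod 2), (∏ i, (p (s i)).toReal) *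
    (if ∃ k, c.dec k (fun i => c.enc w s i + s i k) ≠ w then 1 else 0)
  have herr0 : ∀ w, 0 ≤ err w := fun w => Finset.sum_nonneg fun s _ =>
    mul_nonneg (Finset.prod_nonneg fun i _ => ENNReal.toReal_nonneg)
      (by split_ifs <;> norm_num)
  have hD : ∀ k, ∑ w, ((D k w).card : ℝ) = 2 ^ n := by
    intro k
    have := Finset.card_eq_sum_card_fiberwise (f := c.dec k) (s := Finset.univ)
      (t := Finset.univ) (by simp)
    rw [Finset.card_univ, Fintype.card_fun, ZMod.card, Fintype.card_fin] at this
    exact_mod_cast this.symm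
  -- The weight makes each family of regions contribute `1 / 8` on average, like the error. A
  -- message with total at most `3 / 8` thus has small error and two small regions at once.
  have hsum : ∑ w, (err w + ((D 0 w).card + (D 1 w).card) * (M / (8 * 2 ^ n))) ≤
      ∑ _w : Fin M, (3 / 8 : ℝ) := by
    rw [errorProb_noiselessBinaryChannel, ← Finset.mul_sum] at herr
    have h1 : ∑ w, err w ≤ M * (1 / 8) := by
      rw [one_div, inv_mul_le_iff₀ hM0] at herr
      exact herr
    rw [Finset.sum_add_distrib, ← Finset.sum_mul, Finset.sum_add_distrib, hD, hD,
      Finset.sum_const, Finset.card_univ, Fintype.card_fin, nsmul_eq_mul]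
    have h2 : ((2 : ℝ) ^ n + 2 ^ n) * (M / (8 * 2 ^ n)) = M * (2 / 8) := by
      field_simp
      ring
    rw [h2]
    linarith
  have : NeZero M := ⟨hM.ne'⟩
  obtain ⟨w, -, hw⟩ := Finset.exists_le_of_sum_le Finset.univ_nonempty hsum
  have hDw : ∀ k, ((D k w).card : ℝ) ≤ 3 * (2 ^ n / M) := by
    intro k
    have h3 : ((D k w).card : ℝ) * (M / (8 * 2 ^ n)) ≤ 3 / 8 := by
      have h0 : (0 : ℝ) ≤ (D 0 w).card * (M / (8 * 2 ^ n)) := by positivity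
      have h1 : (0 : ℝ) ≤ (D 1 w).card * (M / (8 * 2 ^ n)) := by positivity
      have := herr0 w
      rw [add_mul] at hw
      fin_cases k
      · simp only [Fin.zero_eta]; linarith
      · simp only [Fin.mk_one]; linarith
    rw [← le_div_iff₀ (by positivity)] at h3
    refine h3.trans (le_of_eq ?_)
    field_simp
  have herrw : err w ≤ 3 / 8 := by
    have : (0 : ℝ) ≤ ((D 0 w).card + (D 1 w).card) * (M / (8 * 2 ^ n)) := by positivity
    linarith
  let G : Finset (Fin n → ZMod 2) := (D 0 w ×ˢ D 1 w).image fun y => y.1 + y.2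
  have hG : (G.card : ℝ) ≤ 9 * (2 ^ n / M) ^ 2 := by
    have h1 : (G.card : ℝ) ≤ (D 0 w).card * (D 1 w).card := by
      have := Finset.card_image_le (s := D 0 w ×ˢ D 1 w) (f := fun y => y.1 + y.2)
      rw [Finset.card_product] at this
      exact_mod_cast this
    refine h1.trans ((mul_le_mul (hDw 0) (hDw 1) (by positivity) (by positivity)).trans
      (le_of_eq (by ring)))
  have hone : 1 - err w ≤ ∑ s : Fin n → (Fin 2 → ZMod 2), (∏ i, (p (s i)).toReal) *
      (if (fun i => s i 0 + s i 1) ∈ G then 1 else 0) := by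
    have h1 : ∑ s : Fin n → (Fin 2 → ZMod 2), ∏ i, (p (s i)).toReal = 1 := by
      rw [sum_pi_prod (fun _ a => (p a).toReal)]
      simp [PMF.sum_toReal]
    rw [show 1 - err w = _ - err w from congrArg (· - err w) h1.symm, ← Finset.sum_sub_distrib]
    refine Finset.sum_le_sum fun s _ => ?_
    have h0 : 0 ≤ ∏ i, (p (s i)).toReal := Finset.prod_nonneg fun i _ => ENNReal.toReal_nonneg
    by_cases hs : ∃ k, c.dec k (fun i => c.enc w s i + s i k) ≠ w
    · rw [if_pos hs, mul_one, sub_self]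
      exact mul_nonneg h0 (by split_ifs <;> norm_num)
    · rw [if_neg hs]
      push Not at hs
      -- The two outputs share the input, which cancels modulo two.
      have hmem : (fun i => s i 0 + s i 1) ∈ G := by
        refine Finset.mem_image.2 ⟨(fun i => c.enc w s i + s i 0, fun i => c.enc w s i + s i 1),
          Finset.mem_product.2 ⟨?_, ?_⟩, ?_⟩
        · exact Finset.mem_filter.2 ⟨Finset.mem_univ _, hs 0⟩
        · exact Finset.mem_filter.2 ⟨Finset.mem_univ _, hs 1⟩
        · funext i
          simp only [Pi.add_apply]
          rw [add_add_add_comm, CharTwo.add_self_eq_zero, zero_add]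
      rw [if_pos hmem]
      linarith
  rw [PMF.sum_prod_map p (fun s => s 0 + s 1) (fun z => if z ∈ G then (1 : ℝ) else 0)] at hone
  have hfin := sum_prod_indicator_le (q := fun z => ((p.map fun s => s 0 + s 1) z).toReal)
    (fun _ => ENNReal.toReal_nonneg) G hθ
  have hGθ := mul_le_mul_of_nonneg_right hG hθ
  replace hone := hone.trans (le_trans (le_of_eq (by congr!)) hfin)
  linarith

theorem le_of_achievable (p : PMF (Fin 2 → ZMod 2)) {R : ℝ}
    (h : (noiselessBinaryChannel p).Achievable R) :
    R ≤ 1 - 1 / 2 * entropyBits (p.map (fun s => s 0 + s 1)) := by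
  set H := entropyBits (p.map (fun s => s 0 + s 1)) with hH
  by_contra hlt
  push Not at hlt
  obtain ⟨-, c, hc⟩ := h
  -- Then `2 (1 - R) - (H - ε) = -ε`, so the counting term decays.
  set ε := R - (1 - 1 / 2 * H) with hε
  have hε0 : 0 < ε := by linarith
  obtain ⟨ρ, hρ0, hρ1, hρ⟩ := exists_atypical_high_bound
    (q := fun z => ((p.map fun s => s 0 + s 1) z).toReal)
    (fun _ => ENNReal.toReal_nonneg) (PMF.sum_toReal _) hH.symm hε0
  have hbound : ∀ᶠ n : ℕ in atTop, (5 / 8 : ℝ) ≤ 9 * ((2 : ℝ) ^ (-ε)) ^ n + ρ ^ n := by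
    filter_upwards [hc.eventually (ge_mem_nhds (show (0 : ℝ) < 1 / 8 by norm_num))] with n hn
    have hpow : (0 : ℝ) < 2 ^ ((n : ℝ) * R) := by positivity
    have h1 := le_of_errorProb_le p (Nat.ceil_pos.2 hpow) (c n) hn
      (θ := (2 : ℝ) ^ (-((n : ℝ) * (H - ε)))) (by positivity)
    have h2 := hρ n Finset.univ
    simp only [Finset.card_univ, Fintype.card_fin] at h2
    refine h1.trans (add_le_add ?_ h2)
    calc 9 * ((2 : ℝ) ^ n / ⌈(2 : ℝ) ^ ((n : ℝ) * R)⌉₊) ^ 2 * 2 ^ (-((n : ℝ) * (H - ε)))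
        ≤ 9 * ((2 : ℝ) ^ n / (2 : ℝ) ^ ((n : ℝ) * R)) ^ 2 * 2 ^ (-((n : ℝ) * (H - ε))) := by
          gcongr
          exact Nat.le_ceil _
      _ = 9 * ((2 : ℝ) ^ (-ε)) ^ n := by
          rw [← Real.rpow_natCast 2 n, ← Real.rpow_natCast _ n, ← Real.rpow_mul zero_le_two,
            mul_assoc, ← Real.rpow_sub zero_lt_two, ← Real.rpow_natCast _ 2,
            ← Real.rpow_mul zero_le_two, ← Real.rpow_add zero_lt_two]
          congr 2
          rw [hε]
          push_cast
          ring
  have hl1 : Tendsto (fun n : ℕ => ρ ^ n) atTop (𝓝 0) :=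
    tendsto_pow_atTop_nhds_zero_of_lt_one hρ0 hρ1
  have hl2 : Tendsto (fun n : ℕ => ((2 : ℝ) ^ (-ε)) ^ n) atTop (𝓝 0) :=
    tendsto_pow_atTop_nhds_zero_of_lt_one (by positivity)
      (Real.rpow_lt_one_of_one_lt_of_neg one_lt_two (by linarith))
  have hlim : Tendsto (fun n : ℕ => 9 * ((2 : ℝ) ^ (-ε)) ^ n + ρ ^ n) atTop (𝓝 0) := by
    simpa using (hl2.const_mul 9).add hl1
  have := ge_of_tendsto hlim hbound
  norm_num at this

theorem theorem1 (p : PMF (Fin 2 → ZMod 2)) :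
    (noiselessBinaryChannel p).IsCapacity
      (1 - 1 / 2 * entropyBits (p.map (fun s => s 0 + s 1))) := by
  refine ⟨fun R hR => le_of_achievable p hR, fun b hb => le_of_forall_lt fun R hR => ?_⟩
  -- Negative rates are not achievable, so they are compared with rate 0 instead.
  by_cases h0 : 0 ≤ R
  · obtain ⟨R', hR', hR''⟩ := exists_between hR
    exact hR'.trans_le (hb (achievable_of_lt p (h0.trans hR'.le) hR''))
  · exact (not_le.1 h0).trans_le (hb (achievable_zero p))
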